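/- **Represented spaces.** A represented space $\mathbf X=(X,\delta_X)$ is a set $X$ with a partial surjection $\delta_X:\subseteq\{0,1\}^{\mathbb N}\to X$; $p$ is a name of $\delta_X(p)$. A map $f:\mathbf X\to\mathbf Y$ is computable (continuous) if there is a computable (continuous) partial function $F:\subseteq\{0,1\}^{\mathbb N}\to\{0,1\}^{\mathbb N}$ that maps every name of every $x\in X$ to a name of $f(x)$; a point is computable if it has a computable name. Products are formed by pairing names. Sierpiński space $\mathbb S=\{\bot,\top\}$ has $0^{\mathbb N}$ as the only name of $\bot$, and all other sequences as names of $\top$. The space $\mathcal C(\mathbf X,\mathbf Y)$ consists of the continuous maps $\mathbf X\to\mathbf Y$, and $0^n1p$ is a name of $f$ if the $n$-th oracle machine with oracle $p$ computes a realizer of $f$. The space $\mathcal O(\mathbf X)$ of open sets is obtained from $\mathcal C(\mathbf X,\mathbb S)$ by identifying $f$ with $f^{-1}(\{\top\})$; its elements form a topology on $X$, to which closures, $T_0$ and $T_1$ refer. The space $\mathcal V(\mathbf X)$ of overt sets is the subspace of $\mathcal O(\mathcal O(\mathbf X))$ consisting of the sets of the form $O_A=\{U\in\mathcal O(\mathbf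 X)\mid U\cap A\neq\emptyset\}$ with $A\subseteq X$, where $O_A$ is identified with the closure $\overline A$. **Theorem 24.** The following are equivalent for a represented space $\mathbf X$: 1. $\mathbf X$ is computably discrete, i.e. $x\mapsto\{x\}:\mathbf X\to\mathcal O(\mathbf X)$ is well-defined and computable. 2. $\mathrm{id}:\mathcal V(\mathbf X)\to\mathcal O(\mathbf X)$ is well-defined and computable, and $\mathbf X$ is $T_0$. 3. $\cap:\mathcal V(\mathbf X)\times\mathcal V(\mathbf X)\to\mathcal V(\mathbf X)$ is well-defined and computable, and $\mathbf X$ is $T_1$. 4. The map $=\;:\mathbf X\times\mathbf X\to\mathbb S$, with value $\top$ at $(x,x)$ and $\bot$ at $(x,y)$ for $x\neq y$, is computable. 5. The diagonal $\Delta_{\mathbf X}=\{(x,x)\mid x\in X\}$ is a computable element of $\mathcal O(\mathbf X\times\mathbf X)$. Likewise, the five statements obtained by replacing "computable" by "continuous" throughout, "computably discrete" by "discrete", and (5) by "$\Delta_{\mathbf X}\in\mathcal O(\mathbf X\times\mathbf X)$", are equivalent. -/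

import Mathlib

universe u v

namespace RepSpaces

open Nat.Partrec (Code)

/-- Cantor space, with its product topology (the one Mathlib puts on `ℕ → Bool`). -/
abbrev Cantor : Type := ℕ → Bool

/-- The sequence `p 0, q 0, p 1, q 1, …`, i.e. the pair of `p` and `q` as one point of Cantor
space. -/
def pair (p q : Cantor) : Cantor := fun n => if n % 2 = 0 then p (n / 2) else q (n / 2)

/-- First component of a paired sequence. -/
def fstSeq (p : Cantor) : Cantor := fun n => p (2 * n)

/-- Second component of a paired sequence. -/
def sndSeq (p : Cantor) : Cantor := fun n => p (2 * n + 1)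

/-- The sequence `0ⁿ 1 p`. -/
def tagged (n : ℕ) (p : Cantor) : Cantor :=
  fun i => if i < n then false else if i = n then true else p (i - n - 1)

theorem tagged_injective {n m : ℕ} {p q : Cantor} (h : tagged n p = tagged m q) :
    n = m ∧ p = q := by
  have key : ∀ {n m : ℕ} {p q : Cantor}, tagged n p = tagged m q → ¬ n < m := by
    intro n m p q h hlt
    have := congrFun h n
    simp [tagged, hlt] at this
  have hnm : n = m := le_antisymm (not_lt.1 (key h.symm)) (not_lt.1 (key h))
  subst hnm
  refine ⟨rfl, funext fun i => ?_⟩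
  have := congrFun h (n + 1 + i)
  have h1 : ¬ (n + 1 + i < n) := by omega
  have h2 : ¬ (n + 1 + i = n) := by omega
  have h3 : n + 1 + i - n - 1 = i := by omega
  simpa [tagged, h1, h2, h3] using this

/-! ### Type-2 machines

A machine with program `c` (a code of a partial recursive function) has an infinite input tape `p`
and an infinite output tape. To find the output cell `i` it inspects longer and longer initial
segments of the input tape. Having read `k` cells, it runs `c` on these cells and on `i`; the
answer `none` means "read one more cell", the answer `some b` means "write `b` in cell `i`", and if
the run of `c` does not halt (or its result is not the number of an answer), nothing is ever
written in cell `i`. -/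

/-- The run of the program `c` for the output cell `i` when `k` cells of the input tape `p` have
been read. -/
def stage (c : Code) (p : Cantor) (i k : ℕ) : Part ℕ :=
  c.eval (Encodable.encode ((List.range k).map p, i))

/-- On input tape `p` the machine with program `c` writes `b` in the output cell `i`. -/
def Outputs (c : Code) (p : Cantor) (i : ℕ) (b : Bool) : Prop :=
  ∃ k, Encodable.encode (some b) ∈ stage c p i k ∧
    ∀ j < k, Encodable.encode (none : Option Bool) ∈ stage c p i j

/-- On input tape `p` the machine with program `c` produces the infinite output `q`. -/
def Computes (c : Code) (p q : Cantor) : Prop := ∀ i, Outputs c p i (q i)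

theorem Outputs.unique {c : Code} {p : Cantor} {i : ℕ} {b b' : Bool}
    (h : Outputs c p i b) (h' : Outputs c p i b') : b = b' := by
  obtain ⟨k, hk, hk'⟩ := h
  obtain ⟨l, hl, hl'⟩ := h'
  rcases lt_trichotomy k l with hlt | rfl | hlt
  · exact absurd (Encodable.encode_injective (Part.mem_unique hk (hl' k hlt))) (by simp)
  · exact Option.some.inj (Encodable.encode_injective (Part.mem_unique hk hl))
  · exact absurd (Encodable.encode_injective (Part.mem_unique hl (hk' l hlt))) (by simp)

theorem Computes.unique {c : Code} {p q q' : Cantor}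
    (h : Computes c p q) (h' : Computes c p q') : q = q' :=
  funext fun i => (h i).unique (h' i)

/-- A partial function on Cantor space is computable if it is the function computed by some
machine (its domain being the set of the inputs on which the output is infinite). -/
def IsComputableFun (F : Cantor →. Cantor) : Prop :=
  ∃ c : Code, ∀ p q, q ∈ F p ↔ Computes c p q

/-- A partial function on Cantor space is continuous if it is so on its domain, with the subspace
topology. -/
def IsContinuousFun (F : Cantor →. Cantor) : Prop := Continuous F.asSubtype

/-! ### Represented spaces -/

/-- A represented space: a set together with a partial surjection from Cantor space onto it. The
partial surjection is given by its graph: `IsName p x` says that `p` is in the domain and is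
mapped to `x`. -/
structure RepresentedSpace where
  /-- the underlying set -/
  carrier : Type u
  /-- the graph of the representation -/
  IsName : Cantor → carrier → Prop
  name_unique : ∀ {p x y}, IsName p x → IsName p y → x = y
  exists_name : ∀ x, ∃ p, IsName p x

instance : CoeSort RepresentedSpace.{u} (Type u) := ⟨RepresentedSpace.carrier⟩

/-- `F` is a realizer of `f`: it maps every name of every point `x` to some name of `f x`. -/
def Realizes {X : RepresentedSpace.{u}} {Y : RepresentedSpace.{v}} (F : Cantor →. Cantor)
    (f : X → Y) : Prop :=
  ∀ p x, X.IsName p x → ∃ q ∈ F p, Y.IsName q (f x)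

/-- A map of represented spaces is computable if it has a computable realizer. -/
def IsComputableMap {X : RepresentedSpace.{u}} {Y : RepresentedSpace.{v}} (f : X → Y) : Prop :=
  ∃ F, IsComputableFun F ∧ Realizes F f

/-- A map of represented spaces is continuous if it has a continuous realizer. -/
def IsContinuousMap {X : RepresentedSpace.{u}} {Y : RepresentedSpace.{v}} (f : X → Y) : Prop :=
  ∃ F, IsContinuousFun F ∧ Realizes F f

/-- A point is computable if it has a computable name. -/
def IsComputablePoint {X : RepresentedSpace.{u}} (x : X) : Prop :=
  ∃ p : Cantor, Computable p ∧ X.IsName p x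

/-- Product of represented spaces. -/
def prod (X : RepresentedSpace.{u}) (Y : RepresentedSpace.{v}) : RepresentedSpace.{max u v} where
  carrier := X × Y
  IsName p z := X.IsName (fstSeq p) z.1 ∧ Y.IsName (sndSeq p) z.2
  name_unique h h' := Prod.ext (X.name_unique h.1 h'.1) (Y.name_unique h.2 h'.2)
  exists_name z := by
    obtain ⟨p, hp⟩ := X.exists_name z.1
    obtain ⟨q, hq⟩ := Y.exists_name z.2
    have h1 : fstSeq (pair p q) = p := by
      funext n; simp [fstSeq, pair]
    have h2 : sndSeq (pair p q) = q := by
      funext n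
      have : (2 * n + 1) / 2 = n := by omega
      simp [sndSeq, pair, Nat.add_mod, this]
    exact ⟨pair p q, by rwa [h1], by rwa [h2]⟩

/-- `0ⁿ 1 p` is a name of the function `f` if the `n`-th machine with oracle `p` computes a
realizer of `f`; access to the oracle `p` besides the input `q` means that the machine works on
the tape `pair p q`. -/
def IsFunctionName (X : RepresentedSpace.{u}) (Y : RepresentedSpace.{v}) (a : Cantor)
    (f : X → Y) : Prop :=
  ∃ (n : ℕ) (p : Cantor), a = tagged n p ∧
    ∀ q x, X.IsName q x → ∃ r, Computes (Denumerable.ofNat Code n) (pair p q) r ∧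
      Y.IsName r (f x)

theorem IsFunctionName.unique {X : RepresentedSpace.{u}} {Y : RepresentedSpace.{v}} {a : Cantor}
    {f g : X → Y} (hf : IsFunctionName X Y a f) (hg : IsFunctionName X Y a g) : f = g := by
  obtain ⟨n, p, rfl, hf⟩ := hf
  obtain ⟨m, p', h, hg⟩ := hg
  obtain ⟨rfl, rfl⟩ := tagged_injective h
  funext x
  obtain ⟨q, hq⟩ := X.exists_name x
  obtain ⟨r, hr, hr'⟩ := hf q x hq
  obtain ⟨s, hs, hs'⟩ := hg q x hq
  obtain rfl := hr.unique hs
  exact Y.name_unique hr' hs'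

/-- The space of continuous functions from `X` to `Y`: all functions that have a name (these are
the continuous ones, since every continuous realizer is computable relative to some oracle). -/
def functionSpace (X : RepresentedSpace.{u}) (Y : RepresentedSpace.{v}) :
    RepresentedSpace.{max u v} where
  carrier := {f : X → Y // ∃ a, IsFunctionName X Y a f}
  IsName a f := IsFunctionName X Y a f.1
  name_unique h h' := Subtype.ext (h.unique h')
  exists_name f := f.2

/-- Sierpiński space, with `⊥ = False` and `⊤ = True`: the zero sequence is the name of `⊥`, every
other sequence is a name of `⊤`. -/
def sierpinski : RepresentedSpace.{0} where
  carrier := Prop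
  IsName p s := s ↔ ∃ i, p i = true
  name_unique h h' := propext (h.trans h'.symm)
  exists_name s := by
    by_cases hs : s
    · exact ⟨fun _ => true, by simp [hs]⟩
    · exact ⟨fun _ => false, by simp [hs]⟩

/-- The characteristic function of a subset, with values in Sierpiński space. -/
def charFun {X : RepresentedSpace.{u}} (U : Set X) : X → sierpinski := fun x => (x ∈ U : Prop)

theorem charFun_injective {X : RepresentedSpace.{u}} {U V : Set X}
    (h : charFun U = charFun V) : U = V := h

/-- A subset is open if its characteristic function is an element of the space of continuous
functions into Sierpiński space. -/
def IsOpenSet {X : RepresentedSpace.{u}} (U : Set X) : Prop :=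
  ∃ a, IsFunctionName X sierpinski a (charFun U)

/-- The space of open subsets of `X`: a continuous `f` from `X` to Sierpiński space is identified
with the preimage of `⊤`. -/
def openSets (X : RepresentedSpace.{u}) : RepresentedSpace.{u} where
  carrier := {U : Set X // IsOpenSet U}
  IsName a U := (IsFunctionName X sierpinski a (charFun U.1))
  name_unique h h' := Subtype.ext (charFun_injective (h.unique h'))
  exists_name U := U.2

/-- The closure of a set in the topology formed by the open subsets. -/
def closureOf {X : RepresentedSpace.{u}} (A : Set X) : Set X :=
  {x | ∀ U : Set X, IsOpenSet U → x ∈ U → (U ∩ A).Nonempty}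

/-- The set of all open sets that meet `A`. -/
def hitting {X : RepresentedSpace.{u}} (A : Set X) : Set (openSets X) :=
  {U | (U.1 ∩ A).Nonempty}

/-- `A` is (the closed representative of) an element of the space of overt subsets: it is closed,
and the set of all open sets that meet it is open. -/
def IsOvertSet {X : RepresentedSpace.{u}} (A : Set X) : Prop :=
  closureOf A = A ∧ IsOpenSet (hitting A)

theorem subset_of_hitting_eq {X : RepresentedSpace.{u}} {A B : Set X} (hB : closureOf B = B)
    (h : hitting A = hitting B) : A ⊆ B := by
  intro x hx
  rw [← hB]
  intro U hU hxU
  have : (⟨U, hU⟩ : openSets X) ∈ hitting A := ⟨x, hxU, hx⟩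
  rw [h] at this
  exact this

/-- The space of overt subsets of `X`. It is the subspace of the space of open sets of open sets
that consists of the sets `hitting A`, where `hitting A` is identified with the closure of `A`. -/
def overtSets (X : RepresentedSpace.{u}) : RepresentedSpace.{u} where
  carrier := {A : Set X // IsOvertSet A}
  IsName a A := IsFunctionName (openSets X) sierpinski a (charFun (hitting A.1))
  name_unique {_ A B} h h' := by
    have hAB : hitting A.1 = hitting B.1 := charFun_injective (h.unique h')
    exact Subtype.ext (Set.Subset.antisymm (subset_of_hitting_eq B.2.1 hAB)
      (subset_of_hitting_eq A.2.1 hAB.symm))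
  exists_name A := A.2.2

/-- The topological `T₀` axiom for the open subsets of `X`. -/
def IsT0 (X : RepresentedSpace.{u}) : Prop :=
  ∀ x y : X, (∀ U : Set X, IsOpenSet U → (x ∈ U ↔ y ∈ U)) → x = y

/-- The topological `T₁` axiom for the open subsets of `X`. -/
def IsT1 (X : RepresentedSpace.{u}) : Prop :=
  ∀ x y : X, x ≠ y → ∃ U : Set X, IsOpenSet U ∧ x ∈ U ∧ y ∉ U

/-- The map `x ↦ {x}` into the open subsets is well-defined and computable. -/
def IsComputablyDiscrete (X : RepresentedSpace.{u}) : Prop :=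
  ∃ h : ∀ x : X, IsOpenSet ({x} : Set X),
    IsComputableMap (X := X) (Y := openSets X) fun x => ⟨{x}, h x⟩

/-- The map `x ↦ {x}` into the open subsets is well-defined and continuous. -/
def IsDiscrete (X : RepresentedSpace.{u}) : Prop :=
  ∃ h : ∀ x : X, IsOpenSet ({x} : Set X),
    IsContinuousMap (X := X) (Y := openSets X) fun x => ⟨{x}, h x⟩

/-- Equality as a map into Sierpiński space. -/
def eqMap (X : RepresentedSpace.{u}) : prod X X → sierpinski :=
  fun z => (z.1 = z.2 : Prop)

/-- The diagonal as a subset of the product space. -/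
def diag (X : RepresentedSpace.{u}) : Set (prod X X) := {z | z.1 = z.2}

end RepSpaces

/-! Computability and continuity are treated at once. A map is realizable relative to a class `P` of
oracles if one machine with an oracle from `P` realizes it. Computable oracles give the computable
maps (`isComputableMap_iff`), arbitrary oracles the continuous ones (`isContinuousMap_iff`), and
`IsOracleClass.discrete_tfae` works for every class closed under pairing and tagging that contains
the constant sequence `true`.

By currying (`isRealizable_uncurry_iff`, which rests on the universal machine `exists_code_eval`),
an effective family of open sets is a semidecidable relation x ∈ U, and an effective family of overt
closed sets is a semidecidable relation "U meets A". So discreteness, semidecidable equality and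
effective openness of the diagonal say the same thing.

If singletons are effectively open, then x ∈ A iff {x} meets A, so overt sets are effectively open.
Conversely, x ↦ cl{x} is always effective into the overt sets, because U meets cl{x} iff x ∈ U; if
overt sets are open, T₀ forces these closures to be singletons, and discreteness follows. In that
case U meets A ∩ B iff the open set U ∩ B meets A, which makes intersection effective. Finally, if
intersection is effective and T₁ holds, x = y iff the whole space meets cl{x} ∩ cl{y} = {x} ∩ {y}.
-/

namespace RepSpaces

open Nat.Partrec (Code)
open Encodable (encode)

/-! ### Initial segments and bounded searches -/

/-- The word formed by the first `k` cells of `p`. -/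
def initial (p : Cantor) (k : ℕ) : List Bool := (List.range k).map p

@[simp] theorem length_initial (p : Cantor) (k : ℕ) : (initial p k).length = k := by
  simp [initial]

theorem getElem?_initial {p : Cantor} {k j : ℕ} (h : j < k) : (initial p k)[j]? = some (p j) := by
  simp [initial, h]

theorem eq_of_getElem?_initial {p : Cantor} {k j : ℕ} {b : Bool}
    (h : (initial p k)[j]? = some b) : p j = b := by
  by_cases hj : j < k
  · rwa [getElem?_initial hj, Option.some_inj] at h
  · simp [initial, hj] at h

theorem take_initial {p : Cantor} {k l : ℕ} (h : l ≤ k) :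
    (initial p k).take l = initial p l := by
  simp [initial, ← List.map_take, List.take_range, h]

theorem initial_eq_iff {p q : Cantor} {k : ℕ} :
    initial p k = initial q k ↔ ∀ j < k, p j = q j := by
  simp [initial]

/-- The word formed by the values of `f` below `n`, if all of them are defined. -/
def collect (f : ℕ → Option Bool) (n : ℕ) : Option (List Bool) :=
  Nat.rec (some []) (fun j acc => acc.bind fun l => (f j).map fun b => l ++ [b]) n

theorem collect_succ (f : ℕ → Option Bool) (n : ℕ) :
    collect f (n + 1) = (collect f n).bind fun l => (f n).map fun b => l ++ [b] := rfl

theorem collect_eq_some {f : ℕ → Option Bool} {p : Cantor} {n : ℕ}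
    (h : ∀ j < n, f j = some (p j)) : collect f n = some (initial p n) := by
  induction n with
  | zero => rfl
  | succ n ih =>
    rw [collect_succ, ih fun j hj => h j (by omega), h n (by omega)]
    simp [initial, List.range_succ]

theorem eq_of_collect_eq_some {f : ℕ → Option Bool} {p : Cantor} {n : ℕ} {l : List Bool}
    (h : ∀ j < n, ∀ b, f j = some b → p j = b) (hl : collect f n = some l) :
    l = initial p n := by
  induction n generalizing l with
  | zero => simpa [collect, initial, eq_comm] using hl
  | succ n ih =>
    rw [collect_succ, Option.bind_eq_some_iff] at hl
    obtain ⟨l', hl', h'⟩ := hl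
    obtain ⟨b, hb, rfl⟩ := Option.map_eq_some_iff.1 h'
    rw [ih (fun j hj => h j (by omega)) hl', ← h n (by omega) b hb]
    simp [initial, List.range_succ]

theorem primrec_collect {α : Type*} [Primcodable α] {f : α → ℕ → Option Bool} {n : α → ℕ}
    (hf : Primrec₂ f) (hn : Primrec n) : Primrec fun a => collect (f a) (n a) := by
  refine Primrec.nat_rec' (h := fun a x => x.2.bind fun l => (f a x.1).map fun b => l ++ [b])
    hn (Primrec.const (some [])) ?_
  refine Primrec.option_bind (Primrec.snd.comp Primrec.snd) ?_
  refine Primrec.option_map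
    (hf.comp (Primrec.fst.comp Primrec.fst) (Primrec.fst.comp (Primrec.snd.comp Primrec.fst))) ?_
  exact Primrec.list_concat.comp (Primrec.snd.comp Primrec.fst) Primrec.snd

/-- The first value of `f` below `n` that is defined. -/
def firstSome (f : ℕ → Option Bool) (n : ℕ) : Option Bool :=
  Nat.rec none (fun j acc => acc <|> f j) n

theorem firstSome_succ (f : ℕ → Option Bool) (n : ℕ) :
    firstSome f (n + 1) = (firstSome f n <|> f n) := rfl

theorem firstSome_mono {f : ℕ → Option Bool} {n m : ℕ} {b : Bool} (hnm : n ≤ m)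
    (h : firstSome f n = some b) : firstSome f m = some b := by
  induction m, hnm using Nat.le_induction with
  | base => exact h
  | succ m _ ih => simp [firstSome_succ, ih]

theorem exists_of_firstSome {f : ℕ → Option Bool} {n : ℕ} {b : Bool}
    (h : firstSome f n = some b) : ∃ j < n, f j = some b := by
  induction n with
  | zero => simp [firstSome] at h
  | succ n ih =>
    rw [firstSome_succ] at h
    cases hn : firstSome f n with
    | none => exact ⟨n, by omega, by simpa [hn] using h⟩
    | some b' =>
      obtain ⟨j, hj, hfj⟩ := ih (by simpa [hn] using h)
      exact ⟨j, by omega, hfj⟩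

theorem exists_firstSome {f : ℕ → Option Bool} {j : ℕ} {b : Bool} (h : f j = some b) :
    ∃ b', firstSome f (j + 1) = some b' := by
  rw [firstSome_succ, h]
  cases firstSome f j <;> simp

theorem firstSome_congr {f g : ℕ → Option Bool} {n : ℕ} (h : ∀ j < n, f j = g j) :
    firstSome f n = firstSome g n := by
  induction n with
  | zero => rfl
  | succ n ih => rw [firstSome_succ, firstSome_succ, ih fun j hj => h j (by omega), h n (by omega)]

theorem primrec_firstSome {α : Type*} [Primcodable α] {f : α → ℕ → Option Bool} {n : α → ℕ}
    (hf : Primrec₂ f) (hn : Primrec n) : Primrec fun a => firstSome (f a) (n a) := by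
  refine Primrec.nat_rec' (h := fun a x => x.2 <|> f a x.1) hn (Primrec.const none) ?_
  exact Primrec.option_orElse.comp (Primrec.snd.comp Primrec.snd)
    (hf.comp Primrec.fst (Primrec.fst.comp Primrec.snd))

/-! ### Simulation of machines on finite words -/

/-- If the length of `w` is the number of the pair `(j, t)`, simulate `t` steps of each of the
runs of `c` for the output cell `i` that lead to an answer after `j` cells of the word `w` have
been read. -/
def attempt (c : Code) (w : List Bool) (i : ℕ) : Option Bool :=
  if ∀ l ∈ List.range w.length.unpair.1, Code.evaln w.length.unpair.2 c (encode (w.take l, i)) =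
      some (encode (none : Option Bool)) then
    if Code.evaln w.length.unpair.2 c (encode (w.take w.length.unpair.1, i)) =
      some (encode (some true)) then some true else
    if Code.evaln w.length.unpair.2 c (encode (w.take w.length.unpair.1, i)) =
      some (encode (some false)) then some false else none
  else none

theorem primrec_attempt : Primrec fun x : Code × List Bool × ℕ => attempt x.1 x.2.1 x.2.2 := by
  have hlen : Primrec fun x : Code × List Bool × ℕ => x.2.1.length.unpair :=
    Primrec.unpair.comp (Primrec.list_length.comp (Primrec.fst.comp Primrec.snd))
  have hev : Primrec fun y : ℕ × Code × List Bool × ℕ =>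
      Code.evaln y.2.2.1.length.unpair.2 y.2.1 (encode (y.2.2.1.take y.1, y.2.2.2)) :=
    Code.primrec_evaln.comp
      (((Primrec.snd.comp (hlen.comp Primrec.snd)).pair (Primrec.fst.comp Primrec.snd)).pair
        (Primrec.encode.comp
          ((Primrec.list_take.comp Primrec.fst
            (Primrec.fst.comp (Primrec.snd.comp Primrec.snd))).pair
            (Primrec.snd.comp (Primrec.snd.comp Primrec.snd)))))
  have hrel : PrimrecRel fun (l : ℕ) (x : Code × List Bool × ℕ) =>
      Code.evaln x.2.1.length.unpair.2 x.1 (encode (x.2.1.take l, x.2.2)) =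
        some (encode (none : Option Bool)) :=
    Primrec.eq.comp hev (Primrec.const _)
  have hj := hev.comp ((Primrec.fst.comp hlen).pair Primrec.id)
  refine Primrec.ite (hrel.forall_mem_list.comp
    (Primrec.list_range.comp (Primrec.fst.comp hlen)) Primrec.id) ?_ (Primrec.const none)
  refine Primrec.ite (Primrec.eq.comp hj (Primrec.const _)) (Primrec.const _) ?_
  exact Primrec.ite (Primrec.eq.comp hj (Primrec.const _)) (Primrec.const _) (Primrec.const _)

theorem outputs_of_attempt {c : Code} {p : Cantor} {i k : ℕ} {b : Bool}
    (h : attempt c (initial p k) i = some b) : Outputs c p i b := by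
  unfold attempt at h
  rw [length_initial] at h
  have hk := k.unpair_left_le
  split_ifs at h with h1 h2 h2
  all_goals
    rw [take_initial hk] at h2
    obtain rfl := Option.some.inj h
    refine ⟨k.unpair.1, Code.evaln_sound h2, fun j hj => ?_⟩
    have := h1 j (List.mem_range.2 hj)
    rw [take_initial (by omega)] at this
    exact Code.evaln_sound this

/-- The length codes the pair of the number j of cells read and a common time bound for the j + 1
runs involved; being at least j, it leaves enough cells in the word. -/
theorem attempt_of_outputs {c : Code} {p : Cantor} {i : ℕ} {b : Bool} (h : Outputs c p i b) :
    ∃ k, attempt c (initial p k) i = some b := by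
  obtain ⟨j, hj, hlt⟩ := h
  -- Finitely many halting runs have a common time bound, since `Code.evaln` is monotone in it.
  have key : ∀ n, ∃ t, ∀ l < n, l < j → encode (none : Option Bool) ∈
      Code.evaln t c (encode (initial p l, i)) := by
    intro n
    induction n with
    | zero => exact ⟨0, by simp⟩
    | succ n ih =>
      obtain ⟨t, ht⟩ := ih
      by_cases hn : n < j
      · obtain ⟨t', ht'⟩ := Code.evaln_complete.1 (hlt n hn)
        refine ⟨max t t', fun l hl hlj => ?_⟩
        rcases Nat.lt_succ_iff_lt_or_eq.1 hl with hl | rfl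
        · exact Code.evaln_mono (le_max_left _ _) (ht l hl hlj)
        · exact Code.evaln_mono (le_max_right _ _) ht'
      · exact ⟨t, fun l hl hlj => ht l (by omega) hlj⟩
  obtain ⟨t, ht⟩ := key j
  obtain ⟨t', ht'⟩ := Code.evaln_complete.1 hj
  refine ⟨Nat.pair j (max t t'), ?_⟩
  have hle := Nat.left_le_pair j (max t t')
  unfold attempt
  simp only [length_initial, Nat.unpair_pair, take_initial hle]
  rw [if_pos]
  · rw [show Code.evaln (max t t') c (encode (initial p j, i)) = some (encode (some b)) from
      Code.evaln_mono (le_max_right _ _) ht']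
    cases b <;> simp
  · intro l hl
    rw [List.mem_range] at hl
    rw [take_initial (by omega)]
    exact Code.evaln_mono (le_max_left _ _) (ht l hl hl)

/-- The content of the output cell `i` that the machine with program `c` is found to write when
its run is simulated on the initial segment `w` of the input tape. -/
def approx (c : Code) (w : List Bool) (i : ℕ) : Option Bool :=
  firstSome (fun l => attempt c (w.take l) i) (w.length + 1)

theorem primrec_approx : Primrec fun x : Code × List Bool × ℕ => approx x.1 x.2.1 x.2.2 := by
  refine primrec_firstSome ?_
    (Primrec.succ.comp (Primrec.list_length.comp (Primrec.fst.comp Primrec.snd)))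
  exact primrec_attempt.comp ((Primrec.fst.comp Primrec.fst).pair
    ((Primrec.list_take.comp Primrec.snd (Primrec.fst.comp (Primrec.snd.comp Primrec.fst))).pair
      (Primrec.snd.comp (Primrec.snd.comp Primrec.fst))))

attribute [irreducible] approx

theorem primrec_approx_comp {α : Type*} [Primcodable α] {c : α → Code} {w : α → List Bool}
    {i : α → ℕ} (hc : Primrec c) (hw : Primrec w) (hi : Primrec i) :
    Primrec fun a => approx (c a) (w a) (i a) :=
  primrec_approx.comp (hc.pair (hw.pair hi))

theorem approx_initial (c : Code) (p : Cantor) (k i : ℕ) :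
    approx c (initial p k) i = firstSome (fun l => attempt c (initial p l) i) (k + 1) := by
  rw [approx, length_initial]
  exact firstSome_congr fun j hj => by rw [take_initial (by omega)]

theorem outputs_of_approx {c : Code} {p : Cantor} {i k : ℕ} {b : Bool}
    (h : approx c (initial p k) i = some b) : Outputs c p i b := by
  rw [approx_initial] at h
  obtain ⟨l, -, hl⟩ := exists_of_firstSome h
  exact outputs_of_attempt hl

/-- This fails for `attempt`, whose search bounds are decoded from the length and do not grow with
it; `firstSome` repairs this by keeping the first answer found. -/
theorem approx_mono {c : Code} {p : Cantor} {i k m : ℕ} {b : Bool} (hkm : k ≤ m)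
    (h : approx c (initial p k) i = some b) : approx c (initial p m) i = some b := by
  rw [approx_initial] at h ⊢
  exact firstSome_mono (by omega) h

theorem approx_of_outputs {c : Code} {p : Cantor} {i : ℕ} {b : Bool} (h : Outputs c p i b) :
    ∃ k, approx c (initial p k) i = some b := by
  obtain ⟨k, hk⟩ := attempt_of_outputs h
  obtain ⟨b', hb'⟩ := exists_firstSome (f := fun l => attempt c (initial p l) i) hk
  rw [← approx_initial] at hb'
  -- The search may have stopped at another success; determinism of the output makes the answers
  -- agree.
  obtain rfl := h.unique (outputs_of_approx hb')
  exact ⟨k, hb'⟩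

/-- A single initial segment suffices to find finitely many cells of the output. -/
theorem exists_approx_lt {c : Code} {p q : Cantor} (h : Computes c p q) (n : ℕ) :
    ∃ K, ∀ k ≥ K, ∀ i < n, approx c (initial p k) i = some (q i) := by
  induction n with
  | zero => exact ⟨0, by simp⟩
  | succ n ih =>
    obtain ⟨K, hK⟩ := ih
    obtain ⟨k, hk⟩ := approx_of_outputs (h n)
    refine ⟨max K k, fun m hm i hi => ?_⟩
    rcases Nat.lt_succ_iff_lt_or_eq.1 hi with hi | rfl
    · exact hK m (le_trans (le_max_left _ _) hm) i hi
    · exact approx_mono (le_trans (le_max_right _ _) hm) hk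

/-! ### Programs of machines -/

/-- A computable function that finds the cells of the output from initial segments of the input
gives rise to a machine. -/
theorem exists_code_of_computable {R : List Bool → ℕ → Option Bool} (hR : Computable₂ R) :
    ∃ c : Code, ∀ p q : Cantor, (∀ i, ∃ k, R (initial p k) i = some (q i)) →
      (∀ i k b, R (initial p k) i = some b → q i = b) → Computes c p q := by
  obtain ⟨c, hc⟩ := Code.exists_code.1 hR
  have hs : ∀ p i k, stage c p i k = Part.some (encode (R (initial p k) i)) := by
    intro p i k
    rw [stage, hc]
    simp [initial]
  refine ⟨c, fun p q hex hsound i => ?_⟩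
  classical
  -- The machine stops at the first answer of `R`. Before that it reads on: by soundness an earlier
  -- answer would also be `q i`, against minimality.
  refine ⟨Nat.find (hex i), ?_, fun j hj => ?_⟩
  · rw [hs, Nat.find_spec (hex i)]
    exact Part.mem_some _
  · rw [hs]
    have : R (initial p j) i = none := by
      rw [Option.eq_none_iff_forall_not_mem]
      intro b hb
      have hb' : R (initial p j) i = some b := hb
      exact Nat.find_min (hex i) hj (by rw [hb', hsound i j b hb'])
    rw [this]
    exact Part.mem_some _

/-- The length of the word codes how many cells j of the intermediate tape to compute, with a second
component that makes the word long enough to find them all. -/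
theorem exists_code_comp (c d : Code) :
    ∃ e : Code, ∀ p q r, Computes c p q → Computes d q r → Computes e p r := by
  let R : List Bool → ℕ → Option Bool := fun w i =>
    (collect (approx c w) w.length.unpair.1).bind fun l => approx d l i
  have hR : Primrec₂ R := by
    refine Primrec.option_bind (primrec_collect (f := fun (x : List Bool × ℕ) => approx c x.1) ?_
      (Primrec.fst.comp (Primrec.unpair.comp (Primrec.list_length.comp Primrec.fst)))) ?_
    · exact primrec_approx_comp (Primrec.const c) (Primrec.fst.comp Primrec.fst) Primrec.snd
    · exact primrec_approx_comp (Primrec.const d) Primrec.snd (Primrec.snd.comp Primrec.fst)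
  obtain ⟨e, he⟩ := exists_code_of_computable hR.to_comp
  refine ⟨e, fun p q r hq hr => he p r (fun i => ?_) fun i k b h => ?_⟩
  · obtain ⟨j, hj⟩ := approx_of_outputs (hr i)
    obtain ⟨K, hK⟩ := exists_approx_lt hq j
    refine ⟨Nat.pair j K, ?_⟩
    simp only [R, length_initial, Nat.unpair_pair]
    rw [collect_eq_some (hK _ (Nat.right_le_pair _ _))]
    exact hj
  · obtain ⟨l, hl, h⟩ := Option.bind_eq_some_iff.1 h
    obtain rfl := eq_of_collect_eq_some
      (fun j _ b hb => (hq j).unique (outputs_of_approx hb)) hl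
    exact (hr i).unique (outputs_of_approx h)

theorem exists_code_pair (c d : Code) :
    ∃ e : Code, ∀ p q r, Computes c p q → Computes d p r → Computes e p (pair q r) := by
  let R : List Bool → ℕ → Option Bool := fun w i =>
    if i % 2 = 0 then approx c w (i / 2) else approx d w (i / 2)
  have hR : Primrec₂ R := by
    have h2 : Primrec fun x : List Bool × ℕ => x.2 / 2 :=
      Primrec.nat_div.comp Primrec.snd (Primrec.const 2)
    refine Primrec.ite (Primrec.eq.comp (Primrec.nat_mod.comp Primrec.snd (Primrec.const 2))
      (Primrec.const 0)) ?_ ?_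
    · exact primrec_approx_comp (Primrec.const c) Primrec.fst h2
    · exact primrec_approx_comp (Primrec.const d) Primrec.fst h2
  obtain ⟨e, he⟩ := exists_code_of_computable hR.to_comp
  refine ⟨e, fun p q r hq hr => he p _ (fun i => ?_) fun i k b h => ?_⟩
  · simp only [R, pair]
    split_ifs
    · exact approx_of_outputs (hq _)
    · exact approx_of_outputs (hr _)
  · simp only [R, pair] at h ⊢
    split_ifs at h ⊢
    · exact (hq _).unique (outputs_of_approx h)
    · exact (hr _).unique (outputs_of_approx h)

/-- Any conjunction of two cells of the input that are found effectively can be output. -/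
theorem exists_code_and {f g : ℕ → ℕ} (hf : Primrec f) (hg : Primrec g) :
    ∃ e : Code, ∀ p, Computes e p fun i => p (f i) && p (g i) := by
  let R : List Bool → ℕ → Option Bool := fun w i =>
    w[f i]?.bind fun a => w[g i]?.map fun b => a && b
  have hR : Primrec₂ R := by
    refine Primrec.option_bind (Primrec.list_getElem?.comp Primrec.fst (hf.comp Primrec.snd)) ?_
    refine Primrec.option_map (Primrec.list_getElem?.comp (Primrec.fst.comp Primrec.fst)
      (hg.comp (Primrec.snd.comp Primrec.fst))) ?_
    exact Primrec.and.comp (Primrec.snd.comp Primrec.fst) Primrec.snd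
  obtain ⟨e, he⟩ := exists_code_of_computable hR.to_comp
  refine ⟨e, fun p => he p _ (fun i => ⟨max (f i) (g i) + 1, ?_⟩) fun i k b h => ?_⟩
  · simp only [R]
    rw [getElem?_initial (by omega), getElem?_initial (by omega)]
    rfl
  · obtain ⟨a, ha, h⟩ := Option.bind_eq_some_iff.1 h
    obtain ⟨a', ha', rfl⟩ := Option.map_eq_some_iff.1 h
    rw [eq_of_getElem?_initial ha, eq_of_getElem?_initial ha']

theorem exists_code_comp_index {f : ℕ → ℕ} (hf : Primrec f) :
    ∃ e : Code, ∀ p : Cantor, Computes e p fun i => p (f i) := by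
  -- The conjunction of a cell with itself is that cell.
  simpa using exists_code_and hf hf

theorem exists_code_const {q : Cantor} (hq : Computable q) : ∃ e : Code, ∀ p, Computes e p q := by
  obtain ⟨e, he⟩ := exists_code_of_computable (R := fun _ i => some (q i))
    (Computable.option_some.comp (hq.comp Computable.snd))
  exact ⟨e, fun p => he p q (fun i => ⟨0, rfl⟩) fun i k b h => Option.some.inj h⟩

theorem exists_code_tagged (n : ℕ) : ∃ e : Code, ∀ p, Computes e p (tagged n p) := by
  let R : List Bool → ℕ → Option Bool := fun w i =>
    if i < n then some false else if i = n then some true else w[i - n - 1]?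
  have hR : Primrec₂ R := by
    refine Primrec.ite (Primrec.nat_lt.comp Primrec.snd (Primrec.const n)) (Primrec.const _) ?_
    refine Primrec.ite (Primrec.eq.comp Primrec.snd (Primrec.const n)) (Primrec.const _) ?_
    exact Primrec.list_getElem?.comp Primrec.fst (Primrec.nat_sub.comp
      (Primrec.nat_sub.comp Primrec.snd (Primrec.const n)) (Primrec.const 1))
  obtain ⟨e, he⟩ := exists_code_of_computable hR.to_comp
  refine ⟨e, fun p => he p _ (fun i => ⟨i + 1, ?_⟩) fun i k b h => ?_⟩
  · simp only [R, tagged]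
    split_ifs
    · rfl
    · rfl
    · rw [getElem?_initial (by omega)]
  · simp only [R, tagged] at h ⊢
    split_ifs at h ⊢
    · exact Option.some.inj h
    · exact Option.some.inj h
    · exact eq_of_getElem?_initial h

theorem pair_even (p q : Cantor) (n : ℕ) : pair p q (2 * n) = p n := by simp [pair]

theorem pair_odd (p q : Cantor) (n : ℕ) : pair p q (2 * n + 1) = q n := by
  have : (2 * n + 1) / 2 = n := by omega
  simp [pair, Nat.add_mod, this]

/-- The universal machine. -/
theorem exists_code_eval : ∃ e : Code, ∀ n p q r,
    Computes (Denumerable.ofNat Code n) (pair p q) r → Computes e (pair (tagged n p) q) r := by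
  -- The position in `pair (tagged n p) q` of cell j of `pair p q`: cells of `p` are shifted by the
  -- n + 1 cells of the tag, cells of `q` stay.
  let idx : ℕ → ℕ → ℕ := fun n j => if j % 2 = 0 then 2 * (n + 1 + j / 2) else j
  -- The length of the word guesses the program number n and the number of cells of `pair p q` to
  -- rebuild. The guess n is accepted only if the first component is seen to start with n zeros and
  -- a one.
  let R : List Bool → ℕ → Option Bool := fun w i =>
    if collect (fun j => w[2 * j]?) (w.length.unpair.1 + 1) =
        some ((List.range (w.length.unpair.1 + 1)).map fun j => decide (j = w.length.unpair.1)) then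
      (collect (fun j => w[idx w.length.unpair.1 j]?) w.length.unpair.2.unpair.1).bind fun l =>
        approx (Denumerable.ofNat Code w.length.unpair.1) l i
    else none
  have hidx : Primrec₂ idx := by
    refine Primrec.ite (Primrec.eq.comp (Primrec.nat_mod.comp Primrec.snd (Primrec.const 2))
      (Primrec.const 0)) ?_ Primrec.snd
    exact Primrec.nat_mul.comp (Primrec.const 2) (Primrec.nat_add.comp
      (Primrec.succ.comp Primrec.fst) (Primrec.nat_div.comp Primrec.snd (Primrec.const 2)))
  have hlen : Primrec fun x : List Bool × ℕ => x.1.length.unpair :=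
    Primrec.unpair.comp (Primrec.list_length.comp Primrec.fst)
  have hn : Primrec fun x : List Bool × ℕ => x.1.length.unpair.1 := Primrec.fst.comp hlen
  have hR : Primrec₂ R := by
    refine Primrec.ite (Primrec.eq.comp ?_ ?_) ?_ (Primrec.const none)
    · refine primrec_collect (f := fun (x : List Bool × ℕ) j => x.1[2 * j]?) ?_
        (Primrec.succ.comp hn)
      exact Primrec.list_getElem?.comp (Primrec.fst.comp Primrec.fst)
        (Primrec.nat_mul.comp (Primrec.const 2) Primrec.snd)
    · refine Primrec.option_some.comp
        (Primrec.list_map (Primrec.list_range.comp (Primrec.succ.comp hn)) ?_)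
      exact (Primrec.eq.comp Primrec.snd (hn.comp Primrec.fst)).decide
    · refine Primrec.option_bind (primrec_collect
        (f := fun (x : List Bool × ℕ) j => x.1[idx x.1.length.unpair.1 j]?) ?_
        (Primrec.fst.comp (Primrec.unpair.comp (Primrec.snd.comp hlen)))) ?_
      · exact Primrec.list_getElem?.comp (Primrec.fst.comp Primrec.fst)
          (hidx.comp (hn.comp Primrec.fst) Primrec.snd)
      · exact primrec_approx_comp ((Primrec.ofNat Code).comp (hn.comp Primrec.fst)) Primrec.snd
          (Primrec.snd.comp Primrec.fst)
  have htag : ∀ n p j, j < n + 1 → tagged n p j = decide (j = n) := by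
    intro n p j hj
    unfold tagged
    split_ifs with h1 h2
    · simp; omega
    · simp [h2]
    · omega
  have hpair : ∀ n p q j, pair (tagged n p) q (idx n j) = pair p q j := by
    intro n p q j
    simp only [idx]
    split_ifs with h
    · rw [pair_even, pair, if_pos h]
      unfold tagged
      rw [if_neg (by omega), if_neg (by omega)]
      congr 1; omega
    · rw [pair, pair, if_neg h, if_neg h]
  have hidx_le : ∀ n j, idx n j ≤ 2 * (n + 1 + j) := by
    intro n j
    simp only [idx]
    split_ifs <;> omega
  obtain ⟨e, he⟩ := exists_code_of_computable hR.to_comp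
  refine ⟨e, fun n p q r hr => he _ r (fun i => ?_) fun i k b h => ?_⟩
  · obtain ⟨m, hm⟩ := approx_of_outputs (hr i)
    -- Larger than all positions consulted: 2j for j ≤ n, and `idx n j` for j < m.
    set N := 2 * (n + 1 + m) + 1
    refine ⟨Nat.pair n (Nat.pair m N), ?_⟩
    have hk : N ≤ Nat.pair n (Nat.pair m N) :=
      (Nat.right_le_pair m N).trans (Nat.right_le_pair n _)
    generalize hK : Nat.pair n (Nat.pair m N) = K at hk
    have hKn : K.unpair.1 = n := by rw [← hK, Nat.unpair_pair]
    have hKm : K.unpair.2.unpair.1 = m := by rw [← hK, Nat.unpair_pair, Nat.unpair_pair]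
    simp only [R, length_initial, hKn, hKm]
    rw [collect_eq_some (p := tagged n p) fun j hj => by
      rw [getElem?_initial (by omega), pair_even]]
    rw [if_pos, collect_eq_some (p := pair p q) fun j hj => by
      rw [getElem?_initial (by have := hidx_le n j; omega), hpair]]
    · exact hm
    · rw [Option.some_inj, initial]
      exact List.map_congr_left fun j hj => htag n p j (List.mem_range.1 hj)
  · simp only [R, length_initial] at h
    generalize k.unpair.1 = n' at h
    generalize k.unpair.2.unpair.1 = m at h
    split_ifs at h with h1
    have hw := eq_of_collect_eq_some (p := tagged n p) (fun j _ b hb => by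
      rw [← eq_of_getElem?_initial hb, pair_even]) h1
    have heq : ∀ j ≤ n', tagged n p j = decide (j = n') := by
      intro j hj
      have := congrArg (·[j]?) hw
      simp only [initial, List.getElem?_map, List.getElem?_range (show j < n' + 1 by omega),
        Option.map_some, Option.some_inj] at this
      exact this.symm
    -- The first one in the tag determines n, so no wrong guess is accepted.
    have hnn : n' = n := by
      rcases lt_trichotomy n n' with hlt | rfl | hlt
      · have h1 := heq n hlt.le
        rw [htag n p n (by omega)] at h1
        simp [hlt.ne] at h1
      · rfl
      · have h1 := heq n' le_rfl
        rw [htag n p n' (by omega)] at h1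
        simp [hlt.ne] at h1
    subst hnn
    obtain ⟨l, hl, h⟩ := Option.bind_eq_some_iff.1 h
    obtain rfl := eq_of_collect_eq_some (p := pair p q)
      (fun j _ b hb => by rw [← eq_of_getElem?_initial hb, hpair]) hl
    exact (hr i).unique (outputs_of_approx h)

@[simp] theorem fstSeq_pair (p q : Cantor) : fstSeq (pair p q) = p :=
  funext fun n => pair_even p q n

@[simp] theorem sndSeq_pair (p q : Cantor) : sndSeq (pair p q) = q :=
  funext fun n => pair_odd p q n

/-! ### Uniform transformations of families of sequences by machines -/

/-- A single machine computes `s a` from `t a` for all `a`. -/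
def MachineMaps {ι : Type*} (t s : ι → Cantor) : Prop := ∃ c : Code, ∀ a, Computes c (t a) (s a)

namespace MachineMaps

variable {ι κ : Type*} {t s r : ι → Cantor}

theorem precomp (h : MachineMaps t s) (f : κ → ι) :
    MachineMaps (fun a => t (f a)) fun a => s (f a) :=
  h.imp fun _ hc a => hc (f a)

theorem trans (h : MachineMaps t s) (h' : MachineMaps s r) : MachineMaps t r := by
  obtain ⟨c, hc⟩ := h
  obtain ⟨d, hd⟩ := h'
  obtain ⟨e, he⟩ := exists_code_comp c d
  exact ⟨e, fun a => he _ _ _ (hc a) (hd a)⟩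

theorem pair (h : MachineMaps t s) (h' : MachineMaps t r) :
    MachineMaps t fun a => RepSpaces.pair (s a) (r a) := by
  obtain ⟨c, hc⟩ := h
  obtain ⟨d, hd⟩ := h'
  obtain ⟨e, he⟩ := exists_code_pair c d
  exact ⟨e, fun a => he _ _ _ (hc a) (hd a)⟩

theorem refl (t : ι → Cantor) : MachineMaps t t := by
  obtain ⟨e, he⟩ := exists_code_comp_index Primrec.id
  exact ⟨e, fun a => he (t a)⟩

theorem fstSeq (h : MachineMaps t s) : MachineMaps t fun a => RepSpaces.fstSeq (s a) := by
  obtain ⟨e, he⟩ := exists_code_comp_index (f := fun n => 2 * n)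
    (Primrec.nat_mul.comp (Primrec.const 2) Primrec.id)
  exact h.trans ⟨e, fun a => he (s a)⟩

theorem sndSeq (h : MachineMaps t s) : MachineMaps t fun a => RepSpaces.sndSeq (s a) := by
  obtain ⟨e, he⟩ := exists_code_comp_index (f := fun n => 2 * n + 1)
    (Primrec.succ.comp (Primrec.nat_mul.comp (Primrec.const 2) Primrec.id))
  exact h.trans ⟨e, fun a => he (s a)⟩

theorem fst (h : MachineMaps t fun a => RepSpaces.pair (s a) (r a)) : MachineMaps t s := by
  simpa using h.fstSeq

theorem snd (h : MachineMaps t fun a => RepSpaces.pair (s a) (r a)) : MachineMaps t r := by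
  simpa using h.sndSeq

theorem tagged (h : MachineMaps t s) (n : ℕ) :
    MachineMaps t fun a => RepSpaces.tagged n (s a) := by
  obtain ⟨e, he⟩ := exists_code_tagged n
  exact h.trans ⟨e, fun a => he (s a)⟩

theorem const {q : Cantor} (hq : Computable q) : MachineMaps t fun _ => q := by
  obtain ⟨e, he⟩ := exists_code_const hq
  exact ⟨e, fun a => he (t a)⟩

end MachineMaps

/-! ### Maps that are realized by machines with an oracle from a class of oracles -/

/-- The closure properties of the classes of oracles that are considered. -/
structure IsOracleClass (P : Cantor → Prop) : Prop where
  pair : ∀ {p q}, P p → P q → P (pair p q)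
  tagged : ∀ n {p}, P p → P (tagged n p)
  const_true : P fun _ => true

theorem isOracleClass_true : IsOracleClass fun _ => True :=
  ⟨fun _ _ => trivial, fun _ _ _ => trivial, trivial⟩

theorem isOracleClass_computable : IsOracleClass fun p => Computable p where
  pair {p q} hp hq := by
    have h2 : Computable fun n : ℕ => n / 2 :=
      (Primrec.nat_div.comp Primrec.id (Primrec.const 2)).to_comp
    refine (Computable.cond (c := fun n : ℕ => decide (n % 2 = 0)) ?_
      (hp.comp h2) (hq.comp h2)).of_eq fun n => ?_
    · exact (Primrec.eq.comp (Primrec.nat_mod.comp Primrec.id (Primrec.const 2))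
        (Primrec.const 0)).decide.to_comp
    · by_cases h : n % 2 = 0 <;> simp [RepSpaces.pair, h]
  tagged n {p} hp := by
    refine (Computable.cond (c := fun i : ℕ => decide (i < n)) ?_ (Computable.const false)
      (Computable.cond (c := fun i : ℕ => decide (i = n)) ?_ (Computable.const true)
        (hp.comp (f := p) (g := fun i => i - n - 1) ?_))).of_eq fun i => ?_
    · exact (Primrec.nat_lt.comp Primrec.id (Primrec.const n)).decide.to_comp
    · exact (Primrec.eq.comp Primrec.id (Primrec.const n)).decide.to_comp
    · exact (Primrec.nat_sub.comp (Primrec.nat_sub.comp Primrec.id (Primrec.const n))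
        (Primrec.const 1)).to_comp
    · by_cases h : i < n
      · simp [RepSpaces.tagged, h]
      · by_cases h' : i = n <;> simp [RepSpaces.tagged, h, h']
  const_true := Computable.const true

/-- The map `f` is realized by a machine that works with an oracle from the class `P`. -/
def IsRealizable (P : Cantor → Prop) {X : RepresentedSpace.{u}} {Y : RepresentedSpace.{v}}
    (f : X → Y) : Prop :=
  ∃ (c : Code) (o : Cantor), P o ∧ ∀ q x, X.IsName q x →
    ∃ r, Computes c (pair o q) r ∧ Y.IsName r (f x)

/-- The names in a represented space, together with the points that they name. -/
abbrev Names (X : RepresentedSpace.{u}) : Type u := {a : Cantor × X // X.IsName a.1 a.2}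

variable {P : Cantor → Prop}

/-- Choosing one output for each name turns realizability into a statement about families of
sequences, to which the closure properties of `MachineMaps` apply. -/
theorem isRealizable_iff {X : RepresentedSpace.{u}} {Y : RepresentedSpace.{v}} {f : X → Y} :
    IsRealizable P f ↔ ∃ o, P o ∧ ∃ F : Names X → Cantor,
      MachineMaps (fun a => pair o a.1.1) F ∧ ∀ a, Y.IsName (F a) (f a.1.2) := by
  constructor
  · rintro ⟨c, o, ho, h⟩
    choose F hF using fun a : Names X => h a.1.1 a.1.2 a.2
    exact ⟨o, ho, F, ⟨c, fun a => (hF a).1⟩, fun a => (hF a).2⟩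
  · rintro ⟨o, ho, F, ⟨c, hc⟩, hF⟩
    exact ⟨c, o, ho, fun q x hq => ⟨F ⟨(q, x), hq⟩, hc ⟨(q, x), hq⟩, hF ⟨(q, x), hq⟩⟩⟩

theorem IsOracleClass.isRealizable_of_machineMaps (hP : IsOracleClass P)
    {X : RepresentedSpace.{u}} {Y : RepresentedSpace.{v}} {f : X → Y} {F : Names X → Cantor}
    (h : MachineMaps (fun a : Names X => a.1.1) F) (hF : ∀ a, Y.IsName (F a) (f a.1.2)) :
    IsRealizable P f :=
  isRealizable_iff.2 ⟨_, hP.const_true, F, (MachineMaps.refl _).snd.trans h, hF⟩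

theorem IsRealizable.comp (hP : IsOracleClass P) {X Y Z : RepresentedSpace} {g : Y → Z} {f : X → Y}
    (hg : IsRealizable P g) (hf : IsRealizable P f) : IsRealizable P fun x => g (f x) := by
  obtain ⟨o, ho, F, hF, hF'⟩ := isRealizable_iff.1 hf
  obtain ⟨o', ho', G, hG, hG'⟩ := isRealizable_iff.1 hg
  refine isRealizable_iff.2 ⟨pair o o', hP.pair ho ho',
    fun a => G ⟨(F a, f a.1.2), hF' a⟩, ?_, fun a => hG' ⟨(F a, f a.1.2), hF' a⟩⟩
  have h := MachineMaps.refl fun a : Names X => pair (pair o o') a.1.1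
  exact (h.fst.snd.pair ((h.fst.fst.pair h.snd).trans hF)).trans
    (hG.precomp fun a => ⟨(F a, f a.1.2), hF' a⟩)

theorem IsRealizable.prodMk (hP : IsOracleClass P) {X Y Z : RepresentedSpace} {f : X → Y}
    {g : X → Z} (hf : IsRealizable P f) (hg : IsRealizable P g) :
    IsRealizable P (Y := prod Y Z) fun x => (f x, g x) := by
  obtain ⟨o, ho, F, hF, hF'⟩ := isRealizable_iff.1 hf
  obtain ⟨o', ho', G, hG, hG'⟩ := isRealizable_iff.1 hg
  refine isRealizable_iff.2 ⟨pair o o', hP.pair ho ho', fun a => pair (F a) (G a), ?_, fun a => ?_⟩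
  · have h := MachineMaps.refl fun a : Names X => pair (pair o o') a.1.1
    exact ((h.fst.fst.pair h.snd).trans hF).pair ((h.fst.snd.pair h.snd).trans hG)
  · simpa [prod] using And.intro (hF' a) (hG' a)

theorem IsRealizable.of_iff {X : RepresentedSpace} {s t : X → Prop}
    (hs : IsRealizable P (Y := sierpinski) s) (h : ∀ x, t x ↔ s x) :
    IsRealizable P (Y := sierpinski) t := by
  rwa [show t = s from funext fun x => propext (h x)]

theorem IsOracleClass.isRealizable_id (hP : IsOracleClass P) (X : RepresentedSpace) :
    IsRealizable P (X := X) (Y := X) fun x => x :=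
  hP.isRealizable_of_machineMaps (MachineMaps.refl _) fun a => a.2

theorem IsOracleClass.isRealizable_fst (hP : IsOracleClass P) (X Y : RepresentedSpace) :
    IsRealizable P (X := prod X Y) (Y := X) fun z => z.1 :=
  hP.isRealizable_of_machineMaps (MachineMaps.refl _).fstSeq fun a => a.2.1

theorem IsOracleClass.isRealizable_snd (hP : IsOracleClass P) (X Y : RepresentedSpace) :
    IsRealizable P (X := prod X Y) (Y := Y) fun z => z.2 :=
  hP.isRealizable_of_machineMaps (MachineMaps.refl _).sndSeq fun a => a.2.2

theorem isRealizable_const {X Y : RepresentedSpace} {y : Y} {p : Cantor} (hp : P p)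
    (hy : Y.IsName p y) : IsRealizable P (X := X) fun _ => y :=
  isRealizable_iff.2 ⟨p, hp, fun _ => p, (MachineMaps.refl _).fst, fun _ => hy⟩

theorem IsOracleClass.isRealizable_true (hP : IsOracleClass P) (X : RepresentedSpace) :
    IsRealizable P (X := X) (Y := sierpinski) fun _ => True :=
  isRealizable_const (Y := sierpinski) hP.const_true (by simp [sierpinski])

theorem IsRealizable.and (hP : IsOracleClass P) {X : RepresentedSpace} {s t : X → Prop}
    (hs : IsRealizable P (Y := sierpinski) s) (ht : IsRealizable P (Y := sierpinski) t) :
    IsRealizable P (Y := sierpinski) fun x => s x ∧ t x := by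
  have h : IsRealizable P (X := prod sierpinski sierpinski) (Y := sierpinski)
      fun z => z.1 ∧ z.2 := by
    -- Output cell i tests the pair of positions coded by i, so a one appears iff both components
    -- contain a one.
    obtain ⟨e, he⟩ := exists_code_and (f := fun i => 2 * i.unpair.1)
      (g := fun i => 2 * i.unpair.2 + 1)
      (Primrec.nat_mul.comp (Primrec.const 2) (Primrec.fst.comp Primrec.unpair))
      (Primrec.succ.comp (Primrec.nat_mul.comp (Primrec.const 2)
        (Primrec.snd.comp Primrec.unpair)))
    refine hP.isRealizable_of_machineMaps
      (F := fun a i => a.1.1 (2 * i.unpair.1) && a.1.1 (2 * i.unpair.2 + 1))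
      ⟨e, fun a => he _⟩ ?_
    rintro ⟨⟨p, y⟩, h1, h2⟩
    change y.1 ↔ ∃ i, fstSeq p i = true at h1
    change y.2 ↔ ∃ i, sndSeq p i = true at h2
    change (y.1 ∧ y.2) ↔ ∃ i : ℕ, (p (2 * i.unpair.1) && p (2 * i.unpair.2 + 1)) = true
    rw [h1, h2]
    constructor
    · rintro ⟨⟨i, hi⟩, j, hj⟩
      exact ⟨Nat.pair i j, by simpa [Nat.unpair_pair] using ⟨hi, hj⟩⟩
    · rintro ⟨i, hi⟩
      rw [Bool.and_eq_true] at hi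
      exact ⟨⟨_, hi.1⟩, ⟨_, hi.2⟩⟩
  exact h.comp hP (hs.prodMk hP ht)

/-! ### Names of functions and currying -/

/-- Currying: a map is realizable iff, as a map into the function space, it is so. -/
theorem isRealizable_uncurry_iff {X Y Z : RepresentedSpace}
    {f : Z → X → Y} :
    IsRealizable P (X := prod Z X) (fun z => f z.1 z.2) ↔ ∃ o, P o ∧ ∃ F : Names Z → Cantor,
      MachineMaps (fun a => pair o a.1.1) F ∧ ∀ a, IsFunctionName X Y (F a) (f a.1.2) := by
  constructor
  · intro h
    obtain ⟨o, ho, F, hF, hF'⟩ := isRealizable_iff.1 h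
    have hname (a : Names Z × Names X) :
        (prod Z X).IsName (pair a.1.1.1 a.2.1.1) (a.1.1.2, a.2.1.2) := by
      simpa [prod] using And.intro a.1.2 a.2.2
    have h := MachineMaps.refl fun a : Names Z × Names X => pair (pair o a.1.1.1) a.2.1.1
    let N (a : Names Z × Names X) : Names (prod Z X) := ⟨(_, _), hname a⟩
    have h' := hF.precomp N
    obtain ⟨c, hc⟩ := (h.fst.fst.pair (h.fst.snd.pair h.snd)).trans h'
    -- The name consists of the fixed program and, as its oracle, the pair of `o` and the name of
    -- the parameter.
    refine ⟨o, ho, fun a => tagged (encode c) (pair o a.1.1), (MachineMaps.refl _).tagged _,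
      fun a => ⟨encode c, pair o a.1.1, rfl, fun q x hq => ?_⟩⟩
    rw [Denumerable.ofNat_encode]
    exact ⟨_, hc (a, ⟨(q, x), hq⟩), hF' ⟨_, hname (a, ⟨(q, x), hq⟩)⟩⟩
  · rintro ⟨o, ho, F, hF, hF'⟩
    obtain ⟨e, he⟩ := exists_code_eval
    choose n p htag G hG hG' using hF'
    let N (b : Names (prod Z X)) : Names Z := ⟨(fstSeq b.1.1, b.1.2.1), b.2.1⟩
    have h := MachineMaps.refl fun b : Names (prod Z X) => pair o b.1.1
    have h' := ((h.fst.pair h.snd.fstSeq).trans (hF.precomp N)).pair h.snd.sndSeq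
    refine isRealizable_iff.2 ⟨o, ho, fun b => G (N b) (sndSeq b.1.1) b.1.2.2 b.2.2,
      h'.trans ⟨e, fun b => ?_⟩, fun b => hG' (N b) _ _ b.2.2⟩
    beta_reduce
    rw [htag]
    exact he _ _ _ _ (hG (N b) _ _ b.2.2)

/-- A name in `P` becomes the constant argument of the evaluation map, which is the uncurried
identity of the function space. Conversely, program and oracle form a name. -/
theorem exists_isFunctionName_iff (hP : IsOracleClass P) {X Y : RepresentedSpace} {f : X → Y} :
    (∃ p, P p ∧ IsFunctionName X Y p f) ↔ IsRealizable P f := by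
  constructor
  · rintro ⟨p, hp, hf⟩
    have h : IsRealizable P (X := functionSpace X Y)
        (Y := functionSpace X Y) fun g => g := hP.isRealizable_id _
    have h' : IsRealizable P (X := prod (functionSpace X Y) X) fun z => z.1.1 z.2 :=
      (isRealizable_uncurry_iff (f := fun g : functionSpace X Y => g.1)).2
        (isRealizable_iff.1 h)
    have hc : IsRealizable P (X := X) (Y := functionSpace X Y) fun _ => ⟨f, p, hf⟩ :=
      isRealizable_const hp hf
    exact h'.comp hP (hc.prodMk hP (hP.isRealizable_id X))
  · rintro ⟨c, o, ho, h⟩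
    refine ⟨tagged (encode c) o, hP.tagged _ ho, encode c, o, rfl, ?_⟩
    rwa [Denumerable.ofNat_encode]

/-! ### Spaces of open sets and of overt sets -/

/-- Currying with values in Sierpiński space. Well-definedness comes for free: each z has a name,
from which a name of `U z` is produced. -/
theorem isRealizable_openSets_iff {X Z : RepresentedSpace}
    {U : Z → Set X} :
    (∃ h : ∀ z, IsOpenSet (U z), IsRealizable P (Y := openSets X) fun z => ⟨U z, h z⟩) ↔
      IsRealizable P (X := prod Z X) (Y := sierpinski) fun z => (z.2 ∈ U z.1 : Prop) := by
  refine Iff.trans ?_ (isRealizable_uncurry_iff (f := fun z => charFun (U z))).symm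
  constructor
  · rintro ⟨h, hU⟩
    exact isRealizable_iff.1 hU
  · intro hU
    obtain ⟨o, ho, F, hF, hF'⟩ := hU
    refine ⟨fun z => ?_, isRealizable_iff.2 ⟨o, ho, F, hF, hF'⟩⟩
    obtain ⟨p, hp⟩ := Z.exists_name z
    exact ⟨_, hF' ⟨(p, z), hp⟩⟩

/-- The same one level up. Only closedness has to be supplied, as it does not follow from a name. -/
theorem isRealizable_overtSets_iff {X Z : RepresentedSpace}
    {A : Z → Set X} (hA : ∀ z, closureOf (A z) = A z) :
    (∃ h : ∀ z, IsOvertSet (A z), IsRealizable P (Y := overtSets X) fun z => ⟨A z, h z⟩) ↔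
      IsRealizable P (X := prod Z (openSets X)) (Y := sierpinski)
        fun z => ((z.2.1 ∩ A z.1).Nonempty : Prop) := by
  refine Iff.trans ?_ (isRealizable_uncurry_iff (f := fun z => charFun (hitting (A z)))).symm
  constructor
  · rintro ⟨h, hU⟩
    exact isRealizable_iff.1 hU
  · intro hU
    obtain ⟨o, ho, F, hF, hF'⟩ := hU
    refine ⟨fun z => ⟨hA z, ?_⟩, isRealizable_iff.2 ⟨o, ho, F, hF, hF'⟩⟩
    obtain ⟨p, hp⟩ := Z.exists_name z
    exact ⟨_, hF' ⟨(p, z), hp⟩⟩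

/-- This is the identity of the space of open sets, uncurried. -/
theorem IsOracleClass.isRealizable_mem (hP : IsOracleClass P) (X : RepresentedSpace) :
    IsRealizable P (X := prod (openSets X) X) (Y := sierpinski)
      fun z => (z.2 ∈ z.1.1 : Prop) :=
  (isRealizable_openSets_iff).1 ⟨fun U : openSets X => U.2, hP.isRealizable_id _⟩

theorem IsOracleClass.isRealizable_hit (hP : IsOracleClass P) (X : RepresentedSpace) :
    IsRealizable P (X := prod (overtSets X) (openSets X)) (Y := sierpinski)
      fun z => ((z.2.1 ∩ z.1.1).Nonempty : Prop) :=
  (isRealizable_overtSets_iff fun A : overtSets X => A.2.1).1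
    ⟨fun A : overtSets X => A.2, hP.isRealizable_id _⟩

/-! ### Computable maps and continuous maps -/

/-- A machine can generate a computable oracle by itself. -/
theorem isComputableMap_iff {X : RepresentedSpace.{u}} {Y : RepresentedSpace.{v}} {f : X → Y} :
    IsComputableMap f ↔ IsRealizable (fun p => Computable p) f := by
  constructor
  · rintro ⟨F, ⟨c, hc⟩, hF⟩
    choose G hG hG' using fun a : Names X => hF a.1.1 a.1.2 a.2
    exact isOracleClass_computable.isRealizable_of_machineMaps
      ⟨c, fun a => (hc _ _).1 (hG a)⟩ hG'
  · intro h
    obtain ⟨o, ho, G, hG, hG'⟩ := isRealizable_iff.1 h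
    have h : MachineMaps (fun a : Names X => a.1.1) G :=
      ((MachineMaps.const ho).pair (MachineMaps.refl _)).trans hG
    obtain ⟨c, hc⟩ := h
    classical
    -- The domain consists of all inputs with infinite output, not only of names, as
    -- `IsComputableFun` demands.
    refine ⟨fun p => ⟨∃ q, Computes c p q, fun h => h.choose⟩, ⟨c, fun p q => ?_⟩,
      fun p x hp => ⟨G ⟨(p, x), hp⟩, ?_, hG' ⟨(p, x), hp⟩⟩⟩
    · exact ⟨fun ⟨h, e⟩ => e ▸ h.choose_spec,
        fun h => ⟨⟨q, h⟩, (Exists.choose_spec (⟨q, h⟩ : ∃ q, Computes c p q)).unique h⟩⟩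
    · have h := hc ⟨(p, x), hp⟩
      exact ⟨⟨_, h⟩, (Exists.choose_spec (⟨_, h⟩ : ∃ q, Computes c p q)).unique h⟩

/-! ### Finite use of the input and continuity on Cantor space -/

theorem Outputs.congr {c : Code} {p : Cantor} {i : ℕ} {b : Bool} (h : Outputs c p i b) :
    ∃ k, ∀ p', initial p' k = initial p k → Outputs c p' i b := by
  obtain ⟨k, hk⟩ := approx_of_outputs h
  exact ⟨k, fun p' hp' => outputs_of_approx (by rwa [hp'])⟩

theorem eventually_initial_eq {α : Type*} [TopologicalSpace α] {f : α → Cantor}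
    (hf : Continuous f) (a : α) (k : ℕ) :
    ∀ᶠ a' in nhds a, initial (f a') k = initial (f a) k := by
  simp_rw [initial_eq_iff]
  refine (Filter.eventually_all_finite (Set.finite_lt_nat k)).2 fun j _ => ?_
  exact ((continuous_apply j).comp hf).continuousAt.eventually
    (isOpen_discrete {f a j} |>.mem_nhds rfl)

theorem exists_initial_subset {S : Set Cantor} {p : Cantor} (hS : S ∈ nhds p) :
    ∃ k, ∀ p', initial p' k = initial p k → p' ∈ S := by
  obtain ⟨U, hUS, hU, hp⟩ := mem_nhds_iff.1 hS
  obtain ⟨I, u, hu, hsub⟩ := isOpen_pi_iff.1 hU p hp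
  refine ⟨I.sup id + 1, fun p' hp' => hUS (hsub fun i hi => ?_)⟩
  rw [initial_eq_iff.1 hp' i (Nat.lt_succ_of_le (Finset.le_sup (f := id) hi))]
  exact (hu i hi).2

theorem continuous_pair (o : Cantor) : Continuous (pair o) := by
  refine continuous_pi fun n => ?_
  unfold pair
  split_ifs
  · exact continuous_const
  · exact continuous_apply _

/-- A continuous partial function is computed by a machine with an oracle. -/
theorem exists_computes_of_isContinuousFun {F : Cantor →. Cantor} (hF : IsContinuousFun F) :
    ∃ (c : Code) (o : Cantor), ∀ p q, q ∈ F p → Computes c (pair o p) q := by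
  classical
  -- The oracle tabulates the triples (l, i, b) for which every input in the domain that extends l
  -- has b in output cell i.
  let o : Cantor := fun n => decide (∃ (l : List Bool) (i : ℕ) (b : Bool), n = encode (l, i, b) ∧
    ∀ p q, q ∈ F p → initial p l.length = l → q i = b)
  have ho : ∀ (l : List Bool) (i : ℕ) (b : Bool), o (encode (l, i, b)) = true ↔
      ∀ p q, q ∈ F p → initial p l.length = l → q i = b := by
    intro l i b
    simp only [o, decide_eq_true_eq]
    constructor
    · rintro ⟨l', i', b', he, h⟩
      obtain ⟨rfl, rfl, rfl⟩ : l = l' ∧ i = i' ∧ b = b' := by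
        simpa using Encodable.encode_injective he
      exact h
    · exact fun h => ⟨l, i, b, rfl, h⟩
  -- The length of the word also guesses the output bit, 0 standing for `true`.
  let bit : ℕ → Bool := fun n => decide (n.unpair.2.unpair.1 = 0)
  let R : List Bool → ℕ → Option Bool := fun w i =>
    (collect (fun j => w[2 * j + 1]?) w.length.unpair.1).bind fun l =>
      if w[2 * encode (l, i, bit w.length)]? = some true then some (bit w.length) else none
  have hR : Primrec₂ R := by
    have hlen : Primrec fun x : List Bool × ℕ => x.1.length := Primrec.list_length.comp Primrec.fst
    have hbit : Primrec bit := (Primrec.eq.comp (Primrec.fst.comp (Primrec.unpair.comp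
      (Primrec.snd.comp Primrec.unpair))) (Primrec.const 0)).decide
    refine Primrec.option_bind (primrec_collect (f := fun (x : List Bool × ℕ) j => x.1[2 * j + 1]?)
      ?_ (Primrec.fst.comp (Primrec.unpair.comp hlen))) ?_
    · exact Primrec.list_getElem?.comp (Primrec.fst.comp Primrec.fst)
        (Primrec.succ.comp (Primrec.nat_mul.comp (Primrec.const 2) Primrec.snd))
    · refine Primrec.ite (Primrec.eq.comp (Primrec.list_getElem?.comp
        (Primrec.fst.comp Primrec.fst) (Primrec.nat_mul.comp (Primrec.const 2)
          (Primrec.encode.comp (Primrec.snd.pair ((Primrec.snd.comp Primrec.fst).pair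
            (hbit.comp (hlen.comp Primrec.fst))))))) (Primrec.const _))
        (Primrec.option_some.comp (hbit.comp (hlen.comp Primrec.fst))) (Primrec.const none)
  obtain ⟨c, hc⟩ := exists_code_of_computable hR.to_comp
  refine ⟨c, o, fun p q hq => hc _ q (fun i => ?_) fun i k b h => ?_⟩
  · have hp : p ∈ F.Dom := Part.dom_iff_mem.2 ⟨q, hq⟩
    -- By continuity at p, some initial segment of p forces output cell i, hence its triple is in
    -- the table.
    have hcont : Continuous fun s : F.Dom => F.asSubtype s i := (continuous_apply i).comp hF
    have hnhds : {s : F.Dom | F.asSubtype s i = q i} ∈ nhds (⟨p, hp⟩ : F.Dom) := by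
      refine hcont.continuousAt.eventually ((isOpen_discrete {q i}).mem_nhds ?_)
      exact congrFun (PFun.asSubtype_eq_of_mem hq hp) i
    obtain ⟨S, hS, hSsub⟩ := mem_nhds_subtype _ _ _ |>.1 hnhds
    obtain ⟨m, hm⟩ := exists_initial_subset hS
    have htab : o (encode (initial p m, i, q i)) = true := by
      rw [ho, length_initial]
      intro p' q' hq' hp'
      have hdom : p' ∈ F.Dom := Part.dom_iff_mem.2 ⟨q', hq'⟩
      have : F.asSubtype ⟨p', hdom⟩ i = q i := hSsub (a := ⟨p', hdom⟩) (hm p' hp')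
      rwa [PFun.asSubtype_eq_of_mem hq'] at this
    set e := encode (initial p m, i, q i)
    have hbit : ∀ N, bit (Nat.pair m (Nat.pair (if q i then 0 else 1) N)) = q i := by
      intro N
      cases h : q i <;> simp [bit, Nat.unpair_pair]
    -- The last component makes the word contain table cell 2e and the cells 2j + 1, j < m, of the
    -- input.
    refine ⟨Nat.pair m (Nat.pair (if q i then 0 else 1) (2 * e + 2 * m + 1)), ?_⟩
    have hle : 2 * e + 2 * m + 1 ≤
        Nat.pair m (Nat.pair (if q i then 0 else 1) (2 * e + 2 * m + 1)) :=
      (Nat.right_le_pair _ _).trans (Nat.right_le_pair _ _)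
    have hb := hbit (2 * e + 2 * m + 1)
    generalize hN : Nat.pair m (Nat.pair (if q i then 0 else 1) (2 * e + 2 * m + 1)) = N at *
    have hNm : N.unpair.1 = m := by rw [← hN, Nat.unpair_pair]
    simp only [R, length_initial, hNm, hb]
    rw [collect_eq_some (p := p) fun j hj => by rw [getElem?_initial (by omega), pair_odd]]
    rw [Option.bind_some, getElem?_initial (by omega), pair_even, htab, if_pos rfl]
  · simp only [R, length_initial] at h
    obtain ⟨l, hl, h⟩ := Option.bind_eq_some_iff.1 h
    have hl := eq_of_collect_eq_some (p := p)
      (fun j _ b hb => by rw [← eq_of_getElem?_initial hb, pair_odd]) hl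
    split_ifs at h with h1
    have h2 := eq_of_getElem?_initial h1
    rw [pair_even, ho] at h2
    rw [h2 p q hq (by rw [hl, length_initial])]
    exact Option.some.inj h

/-- Forward, the oracle is the table of forced outputs. Backward, an output cell depends on finitely
many input cells, so it is locally constant on the domain. -/
theorem isContinuousMap_iff {X : RepresentedSpace.{u}} {Y : RepresentedSpace.{v}} {f : X → Y} :
    IsContinuousMap f ↔ IsRealizable (fun _ => True) f := by
  constructor
  · rintro ⟨F, hF, hreal⟩
    obtain ⟨c, o, h⟩ := exists_computes_of_isContinuousFun hF
    refine ⟨c, o, trivial, fun p x hp => ?_⟩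
    obtain ⟨q, hq, hqn⟩ := hreal p x hp
    exact ⟨q, h p q hq, hqn⟩
  · rintro ⟨c, o, -, h⟩
    classical
    let F : Cantor →. Cantor := fun p => ⟨∃ q, Computes c (pair o p) q, fun h => h.choose⟩
    have hmem : ∀ p q, Computes c (pair o p) q → q ∈ F p := fun p q h =>
      ⟨⟨q, h⟩, (Exists.choose_spec (⟨q, h⟩ : ∃ q, Computes c (pair o p) q)).unique h⟩
    have hspec : ∀ s : F.Dom, Computes c (pair o s.1) (F.asSubtype s) := fun s =>
      Exists.choose_spec (p := fun q => Computes c (pair o s.1) q) s.2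
    refine ⟨F, continuous_pi fun i => continuous_iff_continuousAt.2 fun s => ?_, fun p x hp => ?_⟩
    · obtain ⟨k, hk⟩ := (hspec s i).congr
      refine Filter.Tendsto.congr' ?_ (tendsto_const_nhds (x := F.asSubtype s i))
      filter_upwards [eventually_initial_eq ((continuous_pair o).comp continuous_subtype_val) s k]
        with s' hs'
      exact (hk _ hs').unique (hspec s' i)
    · obtain ⟨r, hr, hrn⟩ := h p x hp
      exact ⟨r, hmem p r hr, hrn⟩

/-! ### Closures of points -/

theorem subset_closureOf {X : RepresentedSpace.{u}} (A : Set X) : A ⊆ closureOf A :=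
  fun x hx _ _ hxU => ⟨x, hxU, hx⟩

/-- Open sets do not distinguish a set from its closure; this is why overt sets may be represented
by closed ones. -/
theorem inter_closureOf_nonempty {X : RepresentedSpace.{u}} {A U : Set X} (hU : IsOpenSet U) :
    (U ∩ closureOf A).Nonempty ↔ (U ∩ A).Nonempty :=
  ⟨fun ⟨_, hxU, hx⟩ => hx U hU hxU,
    fun h => h.mono (Set.inter_subset_inter_right U (subset_closureOf A))⟩

theorem closureOf_closureOf {X : RepresentedSpace.{u}} (A : Set X) :
    closureOf (closureOf A) = closureOf A :=
  (subset_closureOf _).antisymm' fun _ hx U hU hxU =>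
    (inter_closureOf_nonempty hU).1 (hx U hU hxU)

theorem closureOf_eq_of_isOpenSet_singleton {X : RepresentedSpace.{u}}
    (h : ∀ x : X, IsOpenSet ({x} : Set X)) (A : Set X) : closureOf A = A :=
  (subset_closureOf A).antisymm' fun x hx => by
    obtain ⟨y, rfl, hy⟩ := hx {x} (h x) rfl
    exact hy

theorem closureOf_singleton_of_isT1 {X : RepresentedSpace.{u}} (h : IsT1 X) (x : X) :
    closureOf ({x} : Set X) = {x} :=
  (subset_closureOf _).antisymm' fun y hy => by
    by_contra hne
    obtain ⟨U, hU, hyU, hxU⟩ := h y x hne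
    obtain ⟨z, hz, rfl⟩ := hy U hU hyU
    exact hxU hz

/-- If the closures of the points of a `T₀` space are open, then they are singletons. -/
theorem closureOf_singleton_of_isT0 {X : RepresentedSpace.{u}} (hT : IsT0 X)
    (h : ∀ x : X, IsOpenSet (closureOf ({x} : Set X))) (x : X) :
    closureOf ({x} : Set X) = {x} :=
  (subset_closureOf _).antisymm' fun y hy => by
    refine hT y x fun U hU => ⟨fun hyU => ?_, fun hxU => ?_⟩
    · obtain ⟨z, hz, rfl⟩ := hy U hU hyU
      exact hz
    -- The closure of y is an open neighbourhood of y, hence contains x; so every open set around x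
    -- contains y.
    · obtain ⟨z, hz, rfl⟩ := hy _ (h y) (subset_closureOf _ rfl)
      obtain ⟨w, hw, rfl⟩ := hz U hU hxU
      exact hw

theorem isT0_of_isOpenSet_singleton {X : RepresentedSpace.{u}}
    (h : ∀ x : X, IsOpenSet ({x} : Set X)) : IsT0 X :=
  fun x _ hxy => ((hxy {x} (h x)).1 rfl).symm

theorem isT1_of_isOpenSet_singleton {X : RepresentedSpace.{u}}
    (h : ∀ x : X, IsOpenSet ({x} : Set X)) : IsT1 X :=
  fun x _ hxy => ⟨{x}, h x, rfl, fun hy => hxy hy.symm⟩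

variable {P : Cantor → Prop}

/-- The closure of a point is obtained effectively as an overt set. -/
theorem IsOracleClass.isRealizable_closure_singleton (hP : IsOracleClass P)
    (X : RepresentedSpace.{u}) :
    ∃ h : ∀ x : X, IsOvertSet (closureOf ({x} : Set X)),
      IsRealizable P (Y := overtSets X) fun x => ⟨closureOf ({x} : Set X), h x⟩ := by
  refine (isRealizable_overtSets_iff fun x => closureOf_closureOf _).2 ?_
  have h : IsRealizable P (X := prod X (openSets X)) (Y := sierpinski)
      fun z => (z.1 ∈ z.2.1 : Prop) :=
    (hP.isRealizable_mem X).comp hP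
      ((hP.isRealizable_snd X (openSets X)).prodMk hP (hP.isRealizable_fst X (openSets X)))
  exact h.of_iff fun z =>
    (inter_closureOf_nonempty z.2.2).trans Set.inter_singleton_nonempty

/-! ### The equivalence relative to a class of oracles -/

/-- The equivalence of the characterizations of discreteness, relative to a class of oracles. -/
theorem IsOracleClass.discrete_tfae (hP : IsOracleClass P) (X : RepresentedSpace.{u})
    {C : ∀ Y Z : RepresentedSpace.{u}, (Y → Z) → Prop}
    (hC : ∀ Y Z f, C Y Z f ↔ IsRealizable P f) :
    List.TFAE [
      ∃ h : ∀ x : X, IsOpenSet ({x} : Set X),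
        C X (openSets X) fun x => ⟨{x}, h x⟩,
      (∃ h : ∀ A : overtSets X, IsOpenSet A.1,
        C (overtSets X) (openSets X) fun A => ⟨A.1, h A⟩) ∧ IsT0 X,
      (∃ h : ∀ A B : overtSets X, IsOvertSet (A.1 ∩ B.1),
        C (prod (overtSets X) (overtSets X)) (overtSets X)
          fun z => ⟨z.1.1 ∩ z.2.1, h z.1 z.2⟩) ∧ IsT1 X,
      IsRealizable P (eqMap X),
      ∃ p, P p ∧ IsFunctionName (prod X X) sierpinski p (charFun (diag X))] := by
  obtain rfl : C = fun Y Z f => IsRealizable P f :=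
    funext fun Y => funext fun Z => funext fun f => propext (hC Y Z f)
  tfae_have 5 ↔ 4 := exists_isFunctionName_iff hP
  tfae_have 1 ↔ 4 := by
    refine (isRealizable_openSets_iff).trans (iff_of_eq ?_)
    congr 1
    exact funext fun z => propext eq_comm
  tfae_have 1 → 2 := by
    rintro ⟨h, hs⟩
    refine ⟨(isRealizable_openSets_iff (U := fun A : overtSets X => A.1)).2 ?_,
      isT0_of_isOpenSet_singleton h⟩
    -- Membership x ∈ A is tested as "{x} meets A".
    have hm := (hP.isRealizable_hit X).comp hP ((hP.isRealizable_fst (overtSets X) X).prodMk hP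
      (hs.comp hP (hP.isRealizable_snd (overtSets X) X)))
    exact hm.of_iff fun z => Set.singleton_inter_nonempty.symm
  tfae_have 2 → 1 := by
    rintro ⟨⟨h, hid⟩, hT⟩
    obtain ⟨hc, hcl⟩ := hP.isRealizable_closure_singleton X
    have hsing := closureOf_singleton_of_isT0 hT fun x => h ⟨_, hc x⟩
    have key : ∃ h : ∀ x : X, IsOpenSet (closureOf ({x} : Set X)),
        IsRealizable P (Y := openSets X) fun x => ⟨closureOf ({x} : Set X), h x⟩ :=
      ⟨_, hid.comp hP hcl⟩
    simpa only [hsing] using key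
  tfae_have 2 → 3 := by
    intro h2
    obtain ⟨h, -⟩ := tfae_2_to_1 h2
    obtain ⟨⟨_, hid⟩, -⟩ := h2
    refine ⟨?_, isT1_of_isOpenSet_singleton h⟩
    -- As overt sets are effectively open, U ∩ A is effectively open: both memberships are
    -- semidecidable.
    have hmeet : ∃ h : ∀ z : prod (overtSets X) (openSets X), IsOpenSet (z.2.1 ∩ z.1.1),
        IsRealizable P (X := prod (overtSets X) (openSets X)) (Y := openSets X)
          fun z => ⟨z.2.1 ∩ z.1.1, h z⟩ := by
      refine (isRealizable_openSets_iff).2 ?_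
      have hz := hP.isRealizable_fst (prod (overtSets X) (openSets X)) X
      have hx := hP.isRealizable_snd (prod (overtSets X) (openSets X)) X
      have hA := (hP.isRealizable_fst (overtSets X) (openSets X)).comp hP hz
      have hU := (hP.isRealizable_snd (overtSets X) (openSets X)).comp hP hz
      exact ((hP.isRealizable_mem X).comp hP (hU.prodMk hP hx)).and hP
        ((hP.isRealizable_mem X).comp hP ((hid.comp hP hA).prodMk hP hx))
    obtain ⟨_, hmeet⟩ := hmeet
    have key : ∃ h : ∀ z : prod (overtSets X) (overtSets X), IsOvertSet (z.1.1 ∩ z.2.1),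
        IsRealizable P (X := prod (overtSets X) (overtSets X)) (Y := overtSets X)
          fun z => ⟨z.1.1 ∩ z.2.1, h z⟩ := by
      -- Singletons being open, every set is closed, in particular A ∩ B.
      refine (isRealizable_overtSets_iff
        fun z => closureOf_eq_of_isOpenSet_singleton h _).2 ?_
      have hz := hP.isRealizable_fst (prod (overtSets X) (overtSets X)) (openSets X)
      have hU := hP.isRealizable_snd (prod (overtSets X) (overtSets X)) (openSets X)
      have hA := (hP.isRealizable_fst (overtSets X) (overtSets X)).comp hP hz
      have hB := (hP.isRealizable_snd (overtSets X) (overtSets X)).comp hP hz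
      have hm := (hP.isRealizable_hit X).comp hP
        (hA.prodMk hP (hmeet.comp hP (hB.prodMk hP hU)))
      have hset (A B U : Set X) : U ∩ (A ∩ B) = (U ∩ B) ∩ A := by
        rw [Set.inter_assoc, Set.inter_comm B]
      exact hm.of_iff fun z => iff_of_eq (congrArg Set.Nonempty (hset z.1.1.1 z.1.2.1 z.2.1))
    obtain ⟨h', hr⟩ := key
    exact ⟨fun A B => h' (A, B), hr⟩
  tfae_have 3 → 4 := by
    rintro ⟨⟨h, hr⟩, hT⟩
    obtain ⟨hc, hcl⟩ := hP.isRealizable_closure_singleton X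
    have huniv : ∃ h : ∀ z : prod X X, IsOpenSet (Set.univ : Set X),
        IsRealizable P (X := prod X X) (Y := openSets X) fun z => ⟨Set.univ, h z⟩ :=
      (isRealizable_openSets_iff).2 (hP.isRealizable_true _)
    obtain ⟨_, huniv⟩ := huniv
    -- Test whether the whole space meets cl{x} ∩ cl{y}; T₁ reduces this to x = y.
    have hm := (hP.isRealizable_hit X).comp hP ((hr.comp hP
      ((hcl.comp hP (hP.isRealizable_fst X X)).prodMk hP
        (hcl.comp hP (hP.isRealizable_snd X X)))).prodMk hP huniv)
    refine hm.of_iff fun z => ?_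
    change z.1 = z.2 ↔ (Set.univ ∩ (closureOf {z.1} ∩ closureOf {z.2})).Nonempty
    simp only [closureOf_singleton_of_isT1 hT, Set.univ_inter, Set.singleton_inter_nonempty,
      Set.mem_singleton_iff]
  tfae_finish

end RepSpaces

open RepSpaces in
theorem theorem24 (X : RepresentedSpace.{u}) :
    List.TFAE [
      IsComputablyDiscrete X,
      (∃ h : ∀ A : overtSets X, IsOpenSet A.1,
        IsComputableMap (X := overtSets X) (Y := openSets X) fun A => ⟨A.1, h A⟩) ∧ IsT0 X,
      (∃ h : ∀ A B : overtSets X, IsOvertSet (A.1 ∩ B.1),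
        IsComputableMap (X := prod (overtSets X) (overtSets X)) (Y := overtSets X)
          fun z => ⟨z.1.1 ∩ z.2.1, h z.1 z.2⟩) ∧ IsT1 X,
      IsComputableMap (eqMap X),
      ∃ h : IsOpenSet (diag X), IsComputablePoint (X := openSets (prod X X)) ⟨diag X, h⟩] ∧
    List.TFAE [
      IsDiscrete X,
      (∃ h : ∀ A : overtSets X, IsOpenSet A.1,
        IsContinuousMap (X := overtSets X) (Y := openSets X) fun A => ⟨A.1, h A⟩) ∧ IsT0 X,
      (∃ h : ∀ A B : overtSets X, IsOvertSet (A.1 ∩ B.1),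
        IsContinuousMap (X := prod (overtSets X) (overtSets X)) (Y := overtSets X)
          fun z => ⟨z.1.1 ∩ z.2.1, h z.1 z.2⟩) ∧ IsT1 X,
      IsContinuousMap (eqMap X),
      IsOpenSet (diag X)] := by
  constructor
  · have h5 : (∃ h : IsOpenSet (diag X),
        IsComputablePoint (X := openSets (prod X X)) ⟨diag X, h⟩) ↔
        ∃ p, Computable p ∧ IsFunctionName (prod X X) sierpinski p (charFun (diag X)) :=
      -- A computable name already witnesses openness.
      ⟨fun ⟨_, p, hp⟩ => ⟨p, hp⟩, fun ⟨p, hp⟩ => ⟨⟨p, hp.2⟩, p, hp⟩⟩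
    rw [h5, isComputableMap_iff]
    exact isOracleClass_computable.discrete_tfae X (C := fun _ _ f => IsComputableMap f)
      fun _ _ _ => isComputableMap_iff
  · have h5 : IsOpenSet (diag X) ↔
        ∃ p, True ∧ IsFunctionName (prod X X) sierpinski p (charFun (diag X)) := by
      simp only [true_and]; rfl
    rw [h5, isContinuousMap_iff]
    exact isOracleClass_true.discrete_tfae X (C := fun _ _ f => IsContinuousMap f)
      fun _ _ _ => isContinuousMap_iff
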